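/- Let $K$ be a field, $n\ge 1$, $R=K[x_1,\dots,x_n]$, and let $M^d$ be the set of monomials of degree $d$ of $R$. For $m,h\ge 1$ let $h=\sum_{j=i}^{m}\binom{h(j)+j}{j}$ with $h(m)\ge\dots\ge h(i)\ge 0$ and $i\ge 1$ be the $m$th binomial representation of $h$, and put $h^{\langle m\rangle}=\sum_{j=i}^{m}\binom{h(j)+j+1}{j}$; put also $0^{\langle m\rangle}=0$ and $h^{\langle 0\rangle}=h$. A set $V\subset M^d$ is called a Gotzmann set if the ideal $I$ generated by $V$ satisfies $\dim_K I_{d+1}=(\dim_K I_d)^{\langle n-1\rangle}$ (and likewise, with the number of variables in place of $n$, in a polynomial ring in other variables). For $V\subset M^d$ with $|V|>1$ and $u=\gcd(V)$ put $V_{0,i}=\{v\in V: x_iu \text{ divides } v\}$ and $V_{d,i}=V\setminus V_{0,i}$. Binomial coefficients $\binom{m}{k}$ are $0$ unless $0\le k\le m$. Let $V\subset M^d$ be a Gotzmann set with $\gcd(V)=1$, and let $\alpha$ be an integer with $$\binom{\alpha+n-1}{n-1}<|V|\le\binom{\alpha+n}{n-1}.$$ Then: (a) $d=\alpha+1$.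 (b) If $|V|>1$, then $V_{0,i}\neq\emptyset$ and $\gcd(V_{0,i})=x_i$ for every $i$ such that $x_iV_{d,i}\subset\{x_jw : j\ne i,\ w\in V_{0,i}\}$. Moreover, there is an $i$ with this property for which $V_{0,i}$ is a Gotzmann set of $R$ and $V_{d,i}$ is a Gotzmann set of $K[x_1,\dots,x_{i-1},x_{i+1},\dots,x_n]$. (c) The degree is determined by the size: if $V'\subset M^{d'}$ is a Gotzmann set with $\gcd(V')=1$ and $|V'|=|V|$, then $d'=d$. If $|V|=\binom{\alpha+n}{n-1}$, then $V=M^{\alpha+1}$. -/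

import Mathlib

namespace GotzmannMonomial

open MvPolynomial

/-- `c i, …, c n` (with `1 ≤ i ≤ n`) is an `n`-th binomial representation of `h`:
`h = C(c n + n, n) + ⋯ + C(c i + i, i)` with `c n ≥ c (n-1) ≥ ⋯ ≥ c i ≥ 0`. -/
structure IsBinomialRep (n h i : ℕ) (c : ℕ → ℕ) : Prop where
  one_le : 1 ≤ i
  le : i ≤ n
  mono : MonotoneOn c (Set.Icc i n)
  sum_eq : h = ∑ j ∈ Finset.Icc i n, (c j + j).choose j

open Classical in
/-- The number `h^{<n>} = ∑ C(h(j) + j + 1, j)` attached to the (unique) `n`-th binomial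
representation `h = ∑ C(h(j) + j, j)`. A representation exists for all `n, h ≥ 1`; in the two
remaining cases the conventions are `0^{<n>} = 0` and `h^{<0>} = h` (the second one says that in one
variable every set of monomials of a fixed degree is a Gotzmann set). -/
noncomputable def upperPower (n h : ℕ) : ℕ :=
  if H : ∃ p : ℕ × (ℕ → ℕ), IsBinomialRep n h p.1 p.2 then
    ∑ j ∈ Finset.Icc H.choose.1 n, (H.choose.2 j + j + 1).choose j
  else h

/-- The Hilbert function `H(I, k) = dim_K I_k` of an ideal of a polynomial ring. -/
noncomputable def hilbertFunction {σ : Type*} (K : Type*) [Field K]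
    (I : Ideal (MvPolynomial σ K)) (k : ℕ) : ℕ :=
  Module.finrank K ↥(I.restrictScalars K ⊓ homogeneousSubmodule σ K k)

/-- The ideal generated by a set of monomials; a monomial is given by its exponent vector. -/
noncomputable def monomialIdeal {σ : Type*} (K : Type*) [Field K] (V : Finset (σ →₀ ℕ)) :
    Ideal (MvPolynomial σ K) :=
  Ideal.span ((fun v : σ →₀ ℕ => monomial v (1 : K)) '' (V : Set (σ →₀ ℕ)))

/-- `V` is a Gotzmann set of monomials of degree `d` in the variables `x_j`, `j ∈ σ`: all elements
have degree `d`, and the ideal `I` generated by `V` satisfies `H(I, d+1) = H(I, d)^{<n-1>}`, where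
`n` is the number of variables. -/
def IsGotzmannSet {σ : Type*} [Fintype σ] (K : Type*) [Field K] (d : ℕ)
    (V : Finset (σ →₀ ℕ)) : Prop :=
  (∀ v ∈ V, v.degree = d) ∧
    hilbertFunction K (monomialIdeal K V) (d + 1) =
      upperPower (Fintype.card σ - 1) (hilbertFunction K (monomialIdeal K V) d)

/-- The exponent vector of the greatest common divisor of a nonempty finite set of monomials
(divisibility of monomials is `≤` of exponent vectors); the value for `∅` is a dummy. -/
noncomputable def monomialGcd {σ : Type*} (V : Finset (σ →₀ ℕ)) : σ →₀ ℕ :=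
  if h : V.Nonempty then V.inf' h id else 0

open Classical in
/-- `V_{0,i}`: the elements of `V` divisible by `x_i * gcd(V)` if `|V| > 1`, and `V` otherwise. -/
noncomputable def V0 {σ : Type*} (V : Finset (σ →₀ ℕ)) (i : σ) : Finset (σ →₀ ℕ) :=
  if 1 < V.card then V.filter (fun v => Finsupp.single i 1 + monomialGcd V ≤ v) else V

open Classical in
/-- `V_{d,i} = V \ V_{0,i}`. -/
noncomputable def Vd {σ : Type*} (V : Finset (σ →₀ ℕ)) (i : σ) : Finset (σ →₀ ℕ) :=
  V \ V0 V i

open Classical in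
/-- A set of monomials that do not involve `x_i`, read in the variables `x_j`, `j ≠ i`. -/
noncomputable def dropVar {σ : Type*} (V : Finset (σ →₀ ℕ)) (i : σ) :
    Finset ({j : σ // j ≠ i} →₀ ℕ) :=
  V.image (Finsupp.subtypeDomain (fun j => j ≠ i))

/-- `x_i V_{d,i} ⊆ {x_j : j ≠ i} V_{0,i}`. -/
def ShiftCondition {σ : Type*} (V : Finset (σ →₀ ℕ)) (i : σ) : Prop :=
  ∀ v ∈ Vd V i, ∃ j, j ≠ i ∧ ∃ w ∈ V0 V i,
    Finsupp.single i 1 + v = Finsupp.single j 1 + w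

/-- The binomial coefficient `C(m, k)`, with the convention that it is `0` unless `0 ≤ k ≤ m`. -/
def binom (m : ℤ) (k : ℕ) : ℕ :=
  if 0 ≤ m then m.toNat.choose k else 0

end GotzmannMonomial

/-! Put g_m(h) = h^{<m>} - h (`growth`). The products of V with the variables are the degree d+1
monomials of the ideal, so V is Gotzmann exactly when Macaulay's bound |shadow V| ≥ |V| +
g_{n-1}(|V|) is an equality.

Fix x_i and let V have a elements divisible by x_i and b free ones. In m+2 variables, the shadow
elements divisible by x_i number at least a + g_{m+1}(a) and at least a + b; the others are the
shadow of the free part in the remaining variables. By induction the bound reduces to g_{m+1}(a+b) ≤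
max(g_{m+1}(a), b) + g_m(b), which is `growth_succ_add_le`. To prove this, read the increments of
g_m as a word. Its prefix W(m,c) of length C(c+m,m) satisfies W(m+1,c+1) = W(m+1,c) W(m,c+1), where
W(m,0) is the letter m and W(0,c) the letter 0. Among factors of equal length, prefixes have the
largest sum and suffixes the smallest (`isBalanced_growth`).

In the equality case, for each i either the shift condition holds and both parts of V are extremal,
or V is closed under trading x_i for any variable and satisfies a strict size inequality
(`equality_cases`). If the second held for all i, V would be M^d, which violates that inequality. So
a good i exists, which is (b). Dividing V_{0,i} by x_i leaves a coprime extremal set of degree d-1.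
Induction on d and strict subadditivity of g then give |V| > C(d+n-2,n-1) for n ≥ 2
(`choose_lt_card_of_equality`). Since also |V| ≤ |M^d| = C(d+n-1,n-1), the size determines d. -/

namespace GotzmannMonomial

/-! ### Simplex numbers and the growth function -/

/-- The number of monomials of degree `c` in `m + 1` variables. -/
def monomialCount (m c : ℕ) : ℕ := (c + m).choose m

@[simp] lemma monomialCount_zero_left (c : ℕ) : monomialCount 0 c = 1 := by
  simp [monomialCount]

@[simp] lemma monomialCount_zero_right (m : ℕ) : monomialCount m 0 = 1 := by
  simp [monomialCount]

lemma monomialCount_succ (m c : ℕ) :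
    monomialCount (m + 1) (c + 1) = monomialCount (m + 1) c + monomialCount m (c + 1) := by
  have h1 : c + 1 + (m + 1) = (c + (m + 1)) + 1 := by ring
  have h2 : c + 1 + m = c + (m + 1) := by ring
  rw [monomialCount, monomialCount, monomialCount, h1, h2, Nat.choose_succ_succ, add_comm]

lemma monomialCount_pos (m c : ℕ) : 0 < monomialCount m c :=
  Nat.choose_pos (Nat.le_add_left _ _)

lemma strictMono_monomialCount (m : ℕ) : StrictMono (monomialCount (m + 1)) :=
  strictMono_nat_of_lt_succ fun c => by
    have := monomialCount_pos m (c + 1)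
    rw [monomialCount_succ]; omega

lemma lt_monomialCount (m c : ℕ) : c < monomialCount (m + 1) c := by
  induction c with
  | zero => exact monomialCount_pos _ _
  | succ c ih =>
    have := strictMono_monomialCount m (Nat.lt_succ_self c)
    simp only [Nat.succ_eq_add_one] at this
    omega

lemma exists_eq_monomialCount_add (m h : ℕ) (hh : 1 ≤ h) :
    ∃ c r, r < monomialCount m (c + 1) ∧ h = monomialCount (m + 1) c + r := by
  induction h, hh using Nat.le_induction with
  | base => exact ⟨0, 0, monomialCount_pos _ _, by simp⟩
  | succ h _ ih =>
    obtain ⟨c, r, hr, rfl⟩ := ih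
    by_cases h1 : r + 1 < monomialCount m (c + 1)
    · exact ⟨c, r + 1, h1, by ring⟩
    · refine ⟨c + 1, 0, monomialCount_pos _ _, ?_⟩
      rw [monomialCount_succ]; omega

/-- The increments of the function `h ↦ h^{<m>} - h`. -/
def growthStep : ℕ → ℕ → ℕ
  | 0, _ => 0
  | m + 1, 0 => m + 1
  | m + 1, k + 1 => growthStep m (k + 1 - monomialCount (m + 1)
      (Nat.findGreatest (fun c => monomialCount (m + 1) c ≤ k + 1) (k + 1)))

/-- The function `h ↦ h^{<m>} - h`. -/
def growth (m h : ℕ) : ℕ := ∑ k ∈ Finset.range h, growthStep m k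

/-- This is the recursion for words: past W(m+1,c) the letters restart as W(m,c+1). Only position 0
lies in no such block, and its letter m+1 is dictated by 1^{<m+1>} = m+2. -/
lemma growthStep_monomialCount_add {m c r : ℕ} (hr : r < monomialCount m (c + 1)) :
    growthStep (m + 1) (monomialCount (m + 1) c + r) = growthStep m r := by
  obtain ⟨k, hk⟩ : ∃ k, monomialCount (m + 1) c + r = k + 1 :=
    ⟨monomialCount (m + 1) c + r - 1, by have := monomialCount_pos (m + 1) c; omega⟩
  have hc : Nat.findGreatest (fun c => monomialCount (m + 1) c ≤ k + 1) (k + 1) = c := by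
    rw [Nat.findGreatest_eq_iff]
    refine ⟨?_, fun _ => by omega, fun j hj _ hle => ?_⟩
    · have := lt_monomialCount m c
      omega
    · have h1 : monomialCount (m + 1) (c + 1) ≤ monomialCount (m + 1) j :=
        (strictMono_monomialCount m).monotone hj
      rw [monomialCount_succ] at h1
      omega
  rw [hk, growthStep, hc, ← hk, Nat.add_sub_cancel_left]

@[simp] lemma growth_zero_left (h : ℕ) : growth 0 h = 0 := by
  simp [growth, growthStep]

@[simp] lemma growth_zero_right (m : ℕ) : growth m 0 = 0 := by
  simp [growth]

lemma growth_one (m : ℕ) : growth m 1 = m := by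
  cases m <;> simp [growth, growthStep]

lemma growth_mono (m : ℕ) : Monotone (growth m) := fun _ _ hab =>
  Finset.sum_le_sum_of_subset (Finset.range_mono hab)

lemma growth_add_aux {m c r : ℕ} (hr : r ≤ monomialCount m (c + 1)) :
    growth (m + 1) (monomialCount (m + 1) c + r) =
      growth (m + 1) (monomialCount (m + 1) c) + growth m r := by
  rw [growth, Finset.sum_range_add]
  congr 1
  exact Finset.sum_congr rfl fun k hk =>
    growthStep_monomialCount_add ((Finset.mem_range.1 hk).trans_le hr)

lemma growth_monomialCount (m c : ℕ) :
    growth (m + 1) (monomialCount (m + 1) c) = monomialCount m (c + 1) := by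
  induction m generalizing c with
  | zero =>
    induction c with
    | zero => simp [growth_one]
    | succ c ih => rw [monomialCount_succ, growth_add_aux le_rfl, ih]; simp
  | succ m ihm =>
    induction c with
    | zero =>
      rw [monomialCount_zero_right, growth_one, monomialCount, add_comm (0 + 1), zero_add,
        Nat.choose_succ_self_right]
    | succ c ih =>
      rw [monomialCount_succ, growth_add_aux le_rfl, ih, ihm, monomialCount_succ m (c + 1)]

lemma growth_monomialCount_add {m c r : ℕ} (hr : r ≤ monomialCount m (c + 1)) :
    growth (m + 1) (monomialCount (m + 1) c + r) = monomialCount m (c + 1) + growth m r := by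
  rw [growth_add_aux hr, growth_monomialCount]

/-! ### Balanced words -/

/-- For the prefix sums `q` of a word of length `N`: among the factors of a given length, the prefix
has the largest sum and the suffix has the smallest one. -/
structure IsBalanced (q : ℕ → ℕ) (N : ℕ) : Prop where
  sub : ∀ s t, s + t ≤ N → q (s + t) ≤ q s + q t
  sup : ∀ s t u, s ≤ N → t ≤ N → s + t = N + u → q N + q u ≤ q s + q t

/-- A factor inside one of the two words is controlled by that word's balance. One that straddles
the junction is cut there, and `pre` and `suf` compare pieces lying in different words. -/
lemma IsBalanced.concat {q r p : ℕ → ℕ} {N M : ℕ} (hq : IsBalanced q N) (hr : IsBalanced r M)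
    (r0 : r 0 = 0) (hp : ∀ x ≤ N, p x = q x) (hp' : ∀ x ≤ M, p (N + x) = q N + r x)
    (pre : ∀ l ≤ N, l ≤ M → r l ≤ q l)
    (suf : ∀ x y l, x + l = N → y + l = M → r M + q x ≤ q N + r y) :
    IsBalanced p (N + M) := by
  have pre' : ∀ l ≤ M, r l ≤ p l := by
    intro l hl
    rcases le_total l N with h | h
    · rw [hp l h]; exact pre l h hl
    · obtain ⟨e, rfl⟩ := Nat.exists_eq_add_of_le h
      rw [hp' e (by omega)]
      have h1 := hr.sub N e hl
      have h2 := pre N le_rfl (by omega)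
      omega
  have sub_aux : ∀ s t, N ≤ t → s + t ≤ N + M → p (s + t) ≤ p s + p t := by
    intro s t ht hst
    obtain ⟨e, rfl⟩ := Nat.exists_eq_add_of_le ht
    have h1 := hr.sub s e (by omega)
    have h2 := pre' s (by omega)
    rw [show s + (N + e) = N + (s + e) by ring, hp' _ (by omega), hp' _ (by omega)]
    omega
  have sup_aux : ∀ s t u, s < N → N ≤ t → t ≤ N + M → s + t = N + M + u →
      p (N + M) + p u ≤ p s + p t := by
    intro s t u hs ht ht' hstu
    obtain ⟨e, rfl⟩ := Nat.exists_eq_add_of_le ht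
    rw [hp' M le_rfl, hp u (by omega), hp s hs.le, hp' e (by omega)]
    have h1 := suf (N - (M - e)) e (M - e) (by omega) (by omega)
    have h2 := hq.sup (N - (M - e)) s u (by omega) hs.le (by omega)
    omega
  refine ⟨fun s t hst => ?_, fun s t u hs ht hstu => ?_⟩
  · rcases le_total (s + t) N with h | h
    · rw [hp _ h, hp _ (by omega), hp _ (by omega)]
      exact hq.sub s t h
    rcases le_or_gt N t with ht | ht
    · exact sub_aux s t ht hst
    rcases le_or_gt N s with hs | hs
    · have := sub_aux t s hs (by omega)
      rw [add_comm s t]; omega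
    obtain ⟨e, he⟩ := Nat.exists_eq_add_of_le h
    rw [he, hp' e (by omega), hp _ hs.le, hp _ ht.le]
    have h1 := hq.sup s t e hs.le ht.le he
    have h2 := pre e (by omega) (by omega)
    omega
  · rcases le_or_gt N t with ht' | ht'
    · rcases le_or_gt N s with hs' | hs'
      · obtain ⟨a, rfl⟩ := Nat.exists_eq_add_of_le hs'
        obtain ⟨b, rfl⟩ := Nat.exists_eq_add_of_le ht'
        rw [hp' M le_rfl, hp' a (by omega), hp' b (by omega)]
        rcases le_or_gt N u with hu | hu
        · obtain ⟨v, rfl⟩ := Nat.exists_eq_add_of_le hu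
          rw [hp' v (by omega)]
          have := hr.sup a b v (by omega) (by omega) (by omega)
          omega
        · rw [hp u hu.le]
          have h1 := suf u (a + b) (N - u) (by omega) (by omega)
          have h2 := hr.sub a b (by omega)
          omega
      · exact sup_aux s t u hs' ht' ht hstu
    · rcases le_or_gt N s with hs' | hs'
      · have := sup_aux t s u ht' hs' hs (by omega)
        omega
      · rw [hp' M le_rfl, hp u (by omega), hp s hs'.le, hp t ht'.le]
        have h1 := hq.sup s t (M + u) hs'.le ht'.le (by omega)
        have h2 := suf (N - M) 0 M (by omega) (by omega)
        have h3 := hq.sup (M + u) (N - M) u (by omega) (by omega) (by omega)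
        omega

lemma growth_add_le_of_isBalanced {m : ℕ}
    (hm : ∀ c, IsBalanced (growth m) (monomialCount m c)) (hm0 : m ≠ 0) (s t : ℕ) :
    growth m (s + t) ≤ growth m s + growth m t := by
  obtain ⟨k, rfl⟩ := Nat.exists_eq_succ_of_ne_zero hm0
  exact (hm (s + t)).sub s t (lt_monomialCount _ _).le

/-- The word for m+1 is the letter m+1 followed by restarted prefixes of the word for m. By
subadditivity restarting never loses, and the first letter already beats m. -/
lemma growth_lt_growth_succ_of_isBalanced {m : ℕ}
    (hm : ∀ c, IsBalanced (growth m) (monomialCount m c)) {s : ℕ} (hs : 1 ≤ s) :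
    growth m s < growth (m + 1) s := by
  rcases Nat.eq_zero_or_pos m with rfl | hm0
  · have := growth_mono 1 hs
    rw [growth_one] at this
    rwa [growth_zero_left, Nat.lt_iff_add_one_le]
  have sub := growth_add_le_of_isBalanced hm hm0.ne'
  have key : ∀ c, growth m (monomialCount (m + 1) c) <
      growth (m + 1) (monomialCount (m + 1) c) := by
    intro c
    induction c with
    | zero => simp [growth_one]
    | succ c ih =>
      rw [monomialCount_succ, growth_add_aux le_rfl]
      have := sub (monomialCount (m + 1) c) (monomialCount m (c + 1))
      omega
  obtain ⟨c, r, hr, rfl⟩ := exists_eq_monomialCount_add m s hs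
  rw [growth_add_aux hr.le]
  have := sub (monomialCount (m + 1) c) r
  have := key c
  omega

/-- For c > 0 the word W(m₁,c) is literally a suffix of W(m₂,c). Only c = 0, where both are single
letters, can make the inequality strict. -/
lemma growth_suffix_le {m₁ m₂ : ℕ} (hm : m₁ ≤ m₂) (c y z e : ℕ)
    (hy : y + e = monomialCount m₁ c) (hz : z + e = monomialCount m₂ c) :
    growth m₁ (monomialCount m₁ c) + growth m₂ z ≤
      growth m₂ (monomialCount m₂ c) + growth m₁ y := by
  induction m₂, hm using Nat.le_induction generalizing z with
  | base =>
    obtain rfl : y = z := by omega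
    omega
  | succ m₂ hm ih =>
    cases c with
    | zero =>
      simp only [monomialCount_zero_right] at *
      rcases Nat.eq_zero_or_pos e with rfl | he
      · obtain rfl : y = 1 := by omega
        obtain rfl : z = 1 := by omega
        omega
      · obtain rfl : y = 0 := by omega
        obtain rfl : z = 0 := by omega
        simp only [growth_one, growth_zero_right]
        omega
    | succ c =>
      have hle : monomialCount m₁ (c + 1) ≤ monomialCount m₂ (c + 1) := by
        simp only [monomialCount]
        rw [← Nat.choose_symm_add, ← Nat.choose_symm_add (a := c + 1)]
        exact Nat.choose_le_choose _ (by omega)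
      rw [monomialCount_succ] at hz ⊢
      obtain ⟨z', rfl⟩ : ∃ z', z = monomialCount (m₂ + 1) c + z' :=
        Nat.exists_eq_add_of_le (by omega)
      have := ih z' (by omega)
      rw [growth_add_aux (by omega), growth_add_aux le_rfl]
      omega

lemma isBalanced_growth (m c : ℕ) : IsBalanced (growth m) (monomialCount m c) := by
  induction m generalizing c with
  | zero => constructor <;> simp
  | succ m ihm =>
    induction c with
    | zero =>
      constructor
      · intro s t hst
        simp only [monomialCount_zero_right] at hst
        obtain rfl | rfl : s = 0 ∨ t = 0 := by omega
        all_goals simp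
      · intro s t u hs ht hstu
        simp only [monomialCount_zero_right] at *
        obtain ⟨rfl, rfl⟩ | ⟨rfl, rfl⟩ : (s = 1 ∧ t = u) ∨ (t = 1 ∧ s = u) := by omega
        all_goals omega
    | succ c ih =>
      rw [monomialCount_succ]
      refine ih.concat (ihm (c + 1)) (growth_zero_right m) (fun _ _ => rfl)
        (fun x hx => growth_add_aux hx) (fun l _ _ => ?_) ?_
      · rcases Nat.eq_zero_or_pos l with rfl | hl
        · simp
        · exact (growth_lt_growth_succ_of_isBalanced ihm hl).le
      -- The suffix hypothesis of `concat` is proved for every W(k,c+1) with k ≤ m against W(m+1,c),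
      -- so that the recursion W(k+1,c+1) = W(k+1,c) W(k,c+1) can be used.
      · have : ∀ k ≤ m, ∀ x y l, x + l = monomialCount (m + 1) c →
            y + l = monomialCount k (c + 1) →
            growth k (monomialCount k (c + 1)) + growth (m + 1) x ≤
              growth (m + 1) (monomialCount (m + 1) c) + growth k y := by
          intro k
          induction k with
          | zero =>
            intro _ x y l hx _
            have := growth_mono (m + 1) (show x ≤ monomialCount (m + 1) c by omega)
            simpa using this
          | succ k ihk =>
            intro hk x y l hx hy
            rw [monomialCount_succ] at hy ⊢
            rw [growth_add_aux le_rfl]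
            rcases le_total l (monomialCount k (c + 1)) with hl | hl
            · obtain ⟨y', rfl⟩ : ∃ y', y = monomialCount (k + 1) c + y' :=
                Nat.exists_eq_add_of_le (by omega)
              rw [growth_add_aux (by omega)]
              have := ihk (by omega) x y' l hx (by omega)
              omega
            -- The suffix of W(k+1,c+1) is e letters of W(k+1,c) and then all of W(k,c+1). They are
            -- matched crosswise: W(k,c+1) with the start of the window in W(m+1,c), which by
            -- balance is at least its suffix of that length, and the e letters with the window's
            -- last e.
            · obtain ⟨e, rfl⟩ := Nat.exists_eq_add_of_le hl
              have h1 := ih.sup (x + monomialCount k (c + 1)) (x + e) x (by omega) (by omega)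
                (by omega)
              have h2 := ihk (by omega) (x + e) 0 (monomialCount k (c + 1)) (by omega) (by omega)
              have h3 := growth_suffix_le (show k + 1 ≤ m + 1 by omega) c y
                (x + monomialCount k (c + 1)) e (by omega) (by omega)
              simp only [growth_zero_right] at h2
              omega
        exact this m le_rfl

lemma growth_add_le (m s t : ℕ) : growth m (s + t) ≤ growth m s + growth m t := by
  rcases eq_or_ne m 0 with rfl | hm
  · simp
  · exact growth_add_le_of_isBalanced (isBalanced_growth m) hm s t

lemma growth_lt_growth_succ (m : ℕ) {s : ℕ} (hs : 1 ≤ s) : growth m s < growth (m + 1) s :=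
  growth_lt_growth_succ_of_isBalanced (isBalanced_growth m) hs

/-- Strictness comes from `growth_lt_growth_succ`: a nonempty piece past a block boundary is counted
by g_m in the sum, but by g_{m+1} once moved to the front. -/
lemma growth_add_lt (m : ℕ) {s t : ℕ} (hs : 1 ≤ s) (ht : 1 ≤ t) :
    growth (m + 1) (s + t) < growth (m + 1) s + growth (m + 1) t := by
  have aux : ∀ {s c r e : ℕ}, 1 ≤ s → r ≤ monomialCount m (c + 1) → s + e = r →
      growth (m + 1) (monomialCount (m + 1) c + r) <
        growth (m + 1) s + growth (m + 1) (monomialCount (m + 1) c + e) := by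
    intro s c r e hs hr he
    subst he
    rw [growth_add_aux hr, growth_add_aux (by omega)]
    have := growth_add_le m s e
    have := growth_lt_growth_succ m hs
    omega
  obtain ⟨c, r, hr, h⟩ := exists_eq_monomialCount_add m (s + t - 1) (by omega)
  have h' : s + t = monomialCount (m + 1) c + (r + 1) := by omega
  rcases le_or_gt (monomialCount (m + 1) c) t with htc | htc
  · obtain ⟨e, rfl⟩ := Nat.exists_eq_add_of_le htc
    rw [h']
    exact aux hs hr (by omega)
  rcases le_or_gt (monomialCount (m + 1) c) s with hsc | hsc
  · obtain ⟨e, rfl⟩ := Nat.exists_eq_add_of_le hsc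
    rw [h', add_comm (growth _ _)]
    exact aux ht hr (by omega)
  have h1 := (isBalanced_growth (m + 1) c).sup s t (r + 1) hsc.le htc.le h'
  have h2 := growth_lt_growth_succ m (show 1 ≤ r + 1 by omega)
  rw [h', growth_add_aux (r := r + 1) hr]
  omega

/-! ### Numerical inequalities for Macaulay's bound and its equality case -/

/-- The numerical inequality behind Macaulay's lower bound. -/
lemma growth_succ_add_le (m a b : ℕ) :
    growth (m + 1) (a + b) ≤ growth (m + 1) a + growth m b ∨
      growth (m + 1) (a + b) ≤ b + growth m b := by
  induction m generalizing a b with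
  | zero =>
    have h1 : ∀ h, 1 ≤ h → growth 1 h = 1 := by
      intro h hh
      obtain ⟨c, r, hr, rfl⟩ := exists_eq_monomialCount_add 0 h hh
      rw [growth_monomialCount_add hr.le]; simp
    simp only [growth_zero_left, zero_add]
    rcases Nat.eq_zero_or_pos b with rfl | hb
    · simp
    · right; rw [h1 _ (by omega)]; omega
  | succ m ih =>
    rcases Nat.eq_zero_or_pos (a + b) with h0 | h0
    · simp [h0]
    obtain ⟨c, r, hr, h⟩ := exists_eq_monomialCount_add (m + 1) (a + b) h0
    rw [h, growth_monomialCount_add hr.le]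
    rcases le_or_gt (monomialCount (m + 1) (c + 1)) b with hb | hb
    · right
      have h1 := growth_mono (m + 1) (hr.le.trans hb)
      omega
    rcases le_or_gt b r with hbr | hbr
    · left
      obtain ⟨e, rfl⟩ := Nat.exists_eq_add_of_le hbr
      obtain rfl : a = monomialCount (m + 1 + 1) c + e := by omega
      rw [growth_monomialCount_add (by omega)]
      have := growth_add_le (m + 1) b e
      omega
    have hD := growth_monomialCount m c
    rw [monomialCount_succ] at hb ⊢
    -- Here r < b < |W(m+1,c+1)|. If b is shorter than W(m+1,c), balance of that word suffices;
    -- otherwise removing it from b leaves e, and the induction hypothesis applies to e and r.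
    rcases lt_or_ge b (monomialCount (m + 1) c) with hbD | hbD
    · left
      cases c with
      | zero => simp only [monomialCount_zero_right] at hbD; omega
      | succ c =>
        rw [monomialCount_succ (m + 1) c] at h
        obtain ⟨e, he⟩ : ∃ e, a = monomialCount (m + 1 + 1) c + e :=
          Nat.exists_eq_add_of_le (by omega)
        rw [he, growth_monomialCount_add (by omega)]
        have := (isBalanced_growth (m + 1) (c + 1)).sup e b r (by omega) (by omega) (by omega)
        omega
    · obtain ⟨e, rfl⟩ := Nat.exists_eq_add_of_le hbD
      have hb' : growth (m + 1) (monomialCount (m + 1) c + e) = _ :=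
        growth_monomialCount_add (show e ≤ monomialCount m (c + 1) by omega)
      rw [hb']
      rcases le_or_gt r e with her | her
      · right
        have h1 := ih 0 r
        simp only [growth_zero_right, zero_add] at h1
        have h2 := growth_mono m her
        omega
      · obtain ⟨f, rfl⟩ := Nat.exists_eq_add_of_le her.le
        cases c with
        | zero => simp only [monomialCount_zero_right] at hbr; omega
        | succ c =>
          rw [monomialCount_succ (m + 1) c] at h
          obtain rfl : a = monomialCount (m + 1 + 1) c + f := by omega
          rw [growth_monomialCount_add (by omega)]
          have := ih f e
          rw [add_comm f e] at this
          omega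

/-- Equality in the recursion is only possible beyond the next simplex number. -/
lemma monomialCount_lt_add_of_growth_eq {m e a b : ℕ} (hb : 1 ≤ b) (ha : (e + m).choose (m + 1) < a)
    (h : growth (m + 1) (a + b) = growth (m + 1) a + growth m b) :
    monomialCount (m + 1) e < a + b := by
  by_contra! hle
  cases e with
  | zero => simp only [monomialCount_zero_right] at hle; omega
  | succ e =>
    replace ha : monomialCount (m + 1) e < a := by
      rwa [monomialCount, show e + (m + 1) = e + 1 + m by ring]
    obtain ⟨s, rfl⟩ := Nat.exists_eq_add_of_le ha.le
    rw [monomialCount_succ] at hle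
    rw [add_assoc, growth_monomialCount_add (by omega), growth_monomialCount_add (by omega)] at h
    cases m with
    | zero => simp only [monomialCount_zero_left] at hle; omega
    | succ m =>
      have := growth_add_lt m (show 1 ≤ s by omega) hb
      omega

/-! ### Binomial representations -/

lemma monomialCount_mono (m : ℕ) : Monotone (monomialCount m) := fun _ _ h =>
  Nat.choose_le_choose _ (Nat.add_le_add_right h _)

/-- Peel off the top binomial. The second conjunct keeps the remainder inside the next block, where
the recursion for g applies. Every representation gives the same value, so the choice in
`upperPower` is harmless. -/
lemma IsBinomialRep.sum_eq_add_growth {m h i : ℕ} {c : ℕ → ℕ} (H : IsBinomialRep m h i c) :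
    ∑ j ∈ Finset.Icc i m, (c j + j + 1).choose j = h + growth m h ∧
      h < monomialCount m (c m + 1) := by
  induction m generalizing h with
  | zero => have := H.one_le; have := H.le; omega
  | succ m ih =>
    have htop : (c (m + 1) + (m + 1) + 1).choose (m + 1) =
        monomialCount (m + 1) (c (m + 1)) + monomialCount m (c (m + 1) + 1) := by
      rw [← monomialCount_succ, monomialCount]
      congr 1; ring
    have hpos := monomialCount_pos m (c (m + 1) + 1)
    rcases eq_or_lt_of_le H.le with rfl | hi
    · have hh : h = monomialCount (m + 1) (c (m + 1)) := by
        rw [H.sum_eq, Finset.Icc_self, Finset.sum_singleton, monomialCount]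
      rw [Finset.Icc_self, Finset.sum_singleton, htop, hh, growth_monomialCount, monomialCount_succ]
      exact ⟨rfl, by omega⟩
    · have hsum := H.sum_eq
      rw [Finset.sum_Icc_succ_top H.le] at hsum ⊢
      obtain ⟨h1, h2⟩ := ih (h := ∑ j ∈ Finset.Icc i m, (c j + j).choose j)
        ⟨H.one_le, Nat.lt_succ_iff.1 hi, H.mono.mono (Set.Icc_subset_Icc_right (by omega)), rfl⟩
      have h3 : c m ≤ c (m + 1) :=
        H.mono ⟨Nat.lt_succ_iff.1 hi, by omega⟩ ⟨H.le, le_rfl⟩ (by omega)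
      have h4 := monomialCount_mono m (Nat.succ_le_succ h3)
      simp only [Nat.succ_eq_add_one] at h4
      rw [show (c (m + 1) + (m + 1)).choose (m + 1) = monomialCount (m + 1) (c (m + 1)) from rfl,
        add_comm] at hsum
      rw [htop, h1, monomialCount_succ, hsum, growth_monomialCount_add (by omega)]
      omega

lemma exists_isBinomialRep (m h : ℕ) (hh : 1 ≤ h) : ∃ i c, IsBinomialRep (m + 1) h i c := by
  induction m generalizing h with
  | zero => exact ⟨1, fun _ => h - 1, le_rfl, le_rfl, fun _ _ _ _ _ => le_rfl, by simp; omega⟩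
  | succ m ih =>
    obtain ⟨e, r, hr, rfl⟩ := exists_eq_monomialCount_add (m + 1) h hh
    rcases Nat.eq_zero_or_pos r with rfl | hr0
    · exact ⟨m + 2, fun _ => e, by omega, le_rfl, fun _ _ _ _ _ => le_rfl, by simp [monomialCount]⟩
    obtain ⟨i, c, H⟩ := ih r hr0
    have hle := H.le
    have hc : c (m + 1) ≤ e := by
      by_contra! hlt
      have h1 := monomialCount_mono (m + 1) hlt
      have h2 : monomialCount (m + 1) (c (m + 1)) ≤ r := by
        rw [H.sum_eq]
        exact Finset.single_le_sum (f := fun j => (c j + j).choose j) (fun _ _ => Nat.zero_le _)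
          (Finset.mem_Icc.2 ⟨hle, le_rfl⟩)
      simp only [Nat.succ_eq_add_one] at h1
      omega
    refine ⟨i, Function.update c (m + 2) e, H.one_le, by omega, ?_, ?_⟩
    · intro a ha b hb hab
      rcases eq_or_ne b (m + 2) with rfl | hbm
      · rcases eq_or_ne a (m + 2) with rfl | ham
        · exact le_rfl
        · have ha' : a ≤ m + 1 := by have := ha.2; omega
          simpa [Function.update_of_ne ham] using (H.mono ⟨ha.1, ha'⟩ ⟨hle, le_rfl⟩ ha').trans hc
      · have hb' : b ≤ m + 1 := by have := hb.2; omega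
        rw [Function.update_of_ne hbm, Function.update_of_ne (by omega)]
        exact H.mono ⟨ha.1, hab.trans hb'⟩ ⟨hb.1, hb'⟩ hab
    · rw [Finset.sum_Icc_succ_top (by omega), Function.update_self, add_comm]
      congr 1
      rw [H.sum_eq]
      refine Finset.sum_congr rfl fun j hj => ?_
      rw [Function.update_of_ne (by have := (Finset.mem_Icc.1 hj).2; omega)]

lemma upperPower_eq (m h : ℕ) : upperPower m h = h + growth m h := by
  unfold upperPower
  split_ifs with H
  · exact H.choose_spec.sum_eq_add_growth.1
  · rcases Nat.eq_zero_or_pos h with rfl | hh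
    · simp
    cases m with
    | zero => simp
    | succ m =>
      obtain ⟨i, c, hc⟩ := exists_isBinomialRep m h hh
      exact absurd ⟨(i, c), hc⟩ H

/-! ### Hilbert functions of monomial ideals -/

section HilbertFunction

open MvPolynomial

variable {σ : Type*} (K : Type*) [Field K]

lemma hilbertFunction_monomialIdeal (V W : Finset (σ →₀ ℕ)) (k : ℕ)
    (hW : ∀ w, w ∈ W ↔ w.degree = k ∧ ∃ v ∈ V, v ≤ w) :
    hilbertFunction K (monomialIdeal K V) k = W.card := by
  have h : (monomialIdeal K V).restrictScalars K ⊓ homogeneousSubmodule σ K k =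
      restrictSupport K (W : Set (σ →₀ ℕ)) := by
    ext p
    rw [Submodule.mem_inf, Submodule.restrictScalars_mem, monomialIdeal,
      mem_ideal_span_monomial_image, homogeneousSubmodule_eq_finsupp_supported,
      mem_restrictSupport_iff]
    constructor
    · rintro ⟨h1, h2⟩ w hw
      exact (hW w).2 ⟨h2 hw, h1 w hw⟩
    · intro h
      exact ⟨fun w hw => ((hW w).1 (h hw)).2, fun w hw => ((hW w).1 (h hw)).1⟩
  rw [hilbertFunction, h, Module.finrank_eq_nat_card_basis (basisRestrictSupport K _)]
  simp

end HilbertFunction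

/-! ### Shadows and Macaulay's theorem -/

section UpperShadow

variable {σ : Type*}

/-- The monomials in `V` that are divisible by `x_i`. -/
noncomputable def divisiblePart (V : Finset (σ →₀ ℕ)) (i : σ) : Finset (σ →₀ ℕ) :=
  V.filter fun v => v i ≠ 0

/-- The monomials in `V` that are not divisible by `x_i`. -/
noncomputable def freePart (V : Finset (σ →₀ ℕ)) (i : σ) : Finset (σ →₀ ℕ) :=
  V.filter fun v => v i = 0

lemma mem_divisiblePart {V : Finset (σ →₀ ℕ)} {i : σ} {v : σ →₀ ℕ} :
    v ∈ divisiblePart V i ↔ v ∈ V ∧ v i ≠ 0 := Finset.mem_filter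

lemma mem_freePart {V : Finset (σ →₀ ℕ)} {i : σ} {v : σ →₀ ℕ} :
    v ∈ freePart V i ↔ v ∈ V ∧ v i = 0 := Finset.mem_filter

lemma card_divisiblePart_add_card_freePart (V : Finset (σ →₀ ℕ)) (i : σ) :
    (divisiblePart V i).card + (freePart V i).card = V.card := by
  rw [add_comm]
  exact Finset.card_filter_add_card_filter_not _

variable [DecidableEq σ]

/-- The products of a variable `x_j`, `j ∈ S`, with an element of `V`. -/
noncomputable def upperShadow (S : Finset σ) (V : Finset (σ →₀ ℕ)) : Finset (σ →₀ ℕ) :=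
  Finset.image₂ (fun j v => Finsupp.single j 1 + v) S V

lemma mem_upperShadow {S : Finset σ} {V : Finset (σ →₀ ℕ)} {w : σ →₀ ℕ} :
    w ∈ upperShadow S V ↔ ∃ j ∈ S, ∃ v ∈ V, Finsupp.single j 1 + v = w :=
  Finset.mem_image₂

/-- The multiples by `x_i` of the elements of `V`. -/
noncomputable def mulVar (i : σ) (V : Finset (σ →₀ ℕ)) : Finset (σ →₀ ℕ) :=
  V.image (Finsupp.single i 1 + ·)

lemma mem_mulVar {i : σ} {V : Finset (σ →₀ ℕ)} {w : σ →₀ ℕ} :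
    w ∈ mulVar i V ↔ ∃ v ∈ V, Finsupp.single i 1 + v = w :=
  Finset.mem_image

@[simp] lemma card_mulVar (i : σ) (V : Finset (σ →₀ ℕ)) : (mulVar i V).card = V.card :=
  Finset.card_image_of_injective _ (add_right_injective _)

lemma mulVar_subset_upperShadow {i : σ} {S : Finset σ} (hi : i ∈ S) (V : Finset (σ →₀ ℕ)) :
    mulVar i V ⊆ upperShadow S V := fun _ hw => by
  obtain ⟨v, hv, rfl⟩ := mem_mulVar.1 hw
  exact mem_upperShadow.2 ⟨i, hi, v, hv, rfl⟩

lemma upperShadow_mulVar (i : σ) (S : Finset σ) (V : Finset (σ →₀ ℕ)) :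
    upperShadow S (mulVar i V) = mulVar i (upperShadow S V) := by
  ext w
  simp only [mem_upperShadow, mem_mulVar]
  constructor
  · rintro ⟨j, hj, _, ⟨v, hv, rfl⟩, rfl⟩
    exact ⟨_, ⟨j, hj, v, hv, rfl⟩, add_left_comm _ _ _⟩
  · rintro ⟨_, ⟨j, hj, v, hv, rfl⟩, rfl⟩
    exact ⟨j, hj, _, ⟨v, hv, rfl⟩, add_left_comm _ _ _⟩

lemma exists_eq_mulVar {i : σ} {V : Finset (σ →₀ ℕ)} (hV : ∀ v ∈ V, v i ≠ 0) :
    ∃ U, V = mulVar i U := by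
  have h : ∀ v ∈ V, Finsupp.single i 1 + (v - Finsupp.single i 1) = v := fun v hv =>
    add_tsub_cancel_of_le (Finsupp.single_le_iff.2 (Nat.one_le_iff_ne_zero.2 (hV v hv)))
  refine ⟨V.image (· - Finsupp.single i 1), ?_⟩
  ext w
  simp only [mem_mulVar, Finset.mem_image, exists_exists_and_eq_and]
  constructor
  · exact fun hw => ⟨w, hw, h w hw⟩
  · rintro ⟨v, hv, rfl⟩
    rwa [h v hv]

/-- The shadow is sorted by divisibility by x_i; a product free of x_i can only come from a free
monomial and another variable. -/
lemma card_upperShadow {S : Finset σ} {i : σ} (hi : i ∈ S) (V : Finset (σ →₀ ℕ)) :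
    (upperShadow S V).card =
      (upperShadow S (divisiblePart V i) ∪ mulVar i (freePart V i)).card +
        (upperShadow (S.erase i) (freePart V i)).card := by
  rw [← card_divisiblePart_add_card_freePart (upperShadow S V) i]
  congr 2
  · ext w
    simp only [mem_divisiblePart, Finset.mem_union, mem_upperShadow, mem_mulVar, mem_freePart]
    constructor
    · rintro ⟨⟨j, hj, v, hv, rfl⟩, hw⟩
      by_cases hvi : v i = 0
      · rcases eq_or_ne j i with rfl | hji
        · exact Or.inr ⟨v, ⟨hv, hvi⟩, rfl⟩
        · simp [hvi, hji] at hw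
      · exact Or.inl ⟨j, hj, v, ⟨hv, hvi⟩, rfl⟩
    · rintro (⟨j, hj, v, ⟨hv, hvi⟩, rfl⟩ | ⟨v, ⟨hv, hvi⟩, rfl⟩)
      · exact ⟨⟨j, hj, v, hv, rfl⟩, by simp [hvi]⟩
      · exact ⟨⟨i, hi, v, hv, rfl⟩, by simp⟩
  · ext w
    simp only [mem_upperShadow, mem_freePart, Finset.mem_erase]
    constructor
    · rintro ⟨⟨j, hj, v, hv, rfl⟩, hw⟩
      rw [Finsupp.add_apply, Nat.add_eq_zero_iff] at hw
      refine ⟨j, ⟨?_, hj⟩, v, ⟨hv, hw.2⟩, rfl⟩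
      rintro rfl
      simp at hw
    · rintro ⟨j, ⟨hji, hj⟩, v, ⟨hv, hvi⟩, rfl⟩
      exact ⟨⟨j, hj, v, hv, rfl⟩, by simp [hvi, hji]⟩

lemma mulVar_subset_union {S : Finset σ} {i : σ} (hi : i ∈ S) (V : Finset (σ →₀ ℕ)) :
    mulVar i V ⊆ upperShadow S (divisiblePart V i) ∪ mulVar i (freePart V i) := fun w hw => by
  obtain ⟨v, hv, rfl⟩ := mem_mulVar.1 hw
  rw [Finset.mem_union, mem_upperShadow, mem_mulVar]
  by_cases hvi : v i = 0
  · exact Or.inr ⟨v, mem_freePart.2 ⟨hv, hvi⟩, rfl⟩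
  · exact Or.inl ⟨i, hi, v, mem_divisiblePart.2 ⟨hv, hvi⟩, rfl⟩

/-- **Macaulay's theorem** for sets of monomials: `V` has at least `|V|^{<m>}` multiples by one of
`m + 1` variables. -/
theorem card_add_growth_le_card_upperShadow (m : ℕ) (S : Finset σ) (hS : S.card = m + 1)
    (V : Finset (σ →₀ ℕ)) : V.card + growth m V.card ≤ (upperShadow S V).card := by
  induction m generalizing S V with
  | zero =>
    obtain ⟨i, hi⟩ := Finset.card_pos.1 (by omega : 0 < S.card)
    have := Finset.card_le_card (mulVar_subset_upperShadow hi V)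
    simpa using this
  | succ m ihm =>
    obtain ⟨i, hi⟩ := Finset.card_pos.1 (by omega : 0 < S.card)
    -- Dividing the divisible part by x_i preserves the sizes of the set and of its shadow while
    -- lowering the total degree.
    induction hN : ∑ v ∈ V, v.degree using Nat.strong_induction_on generalizing V with
    | _ N ih =>
    have h0 : (divisiblePart V i).card + growth (m + 1) (divisiblePart V i).card ≤
        (upperShadow S (divisiblePart V i)).card := by
      obtain ⟨U, hU⟩ := exists_eq_mulVar (V := divisiblePart V i) (i := i)
        fun v hv => (mem_divisiblePart.1 hv).2
      rw [hU, upperShadow_mulVar, card_mulVar, card_mulVar]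
      rcases U.eq_empty_or_nonempty with rfl | hne
      · simp
      refine ih _ ?_ U rfl
      have h1 : ∑ v ∈ divisiblePart V i, v.degree ≤ N :=
        hN ▸ Finset.sum_le_sum_of_subset (Finset.filter_subset _ _)
      rw [hU, mulVar, Finset.sum_image (add_right_injective _).injOn] at h1
      refine lt_of_lt_of_le (Finset.sum_lt_sum_of_nonempty hne fun u _ => ?_) h1
      simp
    have h1 := ihm (S.erase i) (by rw [Finset.card_erase_of_mem hi]; omega) (freePart V i)
    have h2 := Finset.card_le_card (mulVar_subset_union hi V)
    have h3 := Finset.card_le_card (Finset.subset_union_left (s₁ := upperShadow S (divisiblePart V i))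
      (s₂ := mulVar i (freePart V i)))
    have h4 := growth_succ_add_le m (divisiblePart V i).card (freePart V i).card
    rw [card_divisiblePart_add_card_freePart] at h4
    have h5 := card_divisiblePart_add_card_freePart V i
    rw [card_mulVar] at h2
    rw [card_upperShadow hi]
    omega

/-- The two ways in which equality can hold in Macaulay's theorem, with respect to a variable. -/
lemma equality_cases {m : ℕ} {S : Finset σ} (hS : S.card = m + 2) {i : σ} (hi : i ∈ S)
    {V : Finset (σ →₀ ℕ)} (hV : (upperShadow S V).card = V.card + growth (m + 1) V.card) :
    (mulVar i (freePart V i) ⊆ upperShadow S (divisiblePart V i) ∧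
      (upperShadow S (divisiblePart V i)).card =
        (divisiblePart V i).card + growth (m + 1) (divisiblePart V i).card ∧
      (upperShadow (S.erase i) (freePart V i)).card =
        (freePart V i).card + growth m (freePart V i).card ∧
      growth (m + 1) V.card =
        growth (m + 1) (divisiblePart V i).card + growth m (freePart V i).card) ∨
    ((divisiblePart V i).card + growth (m + 1) (divisiblePart V i).card < V.card ∧
      upperShadow S (divisiblePart V i) ⊆ mulVar i V) := by
  have h0 := card_add_growth_le_card_upperShadow (m + 1) S hS (divisiblePart V i)
  have h1 := card_add_growth_le_card_upperShadow m (S.erase i)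
    (by rw [Finset.card_erase_of_mem hi]; omega) (freePart V i)
  have h2 := Finset.card_le_card (mulVar_subset_union hi V)
  have h3 := Finset.card_le_card (Finset.subset_union_left (s₁ := upperShadow S (divisiblePart V i))
    (s₂ := mulVar i (freePart V i)))
  have h4 := growth_succ_add_le m (divisiblePart V i).card (freePart V i).card
  rw [card_divisiblePart_add_card_freePart] at h4
  have h5 := card_divisiblePart_add_card_freePart V i
  rw [card_upperShadow hi] at hV
  -- The dichotomy is which of the two lower bounds for the union is larger; equality in Macaulay
  -- forces the union to equal the corresponding subset.
  rcases le_or_gt V.card ((divisiblePart V i).card + growth (m + 1) (divisiblePart V i).card)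
    with h | h
  · left
    rw [card_mulVar] at h2
    refine ⟨?_, by omega, by omega, by omega⟩
    have h6 := Finset.eq_of_subset_of_card_le (Finset.subset_union_left
      (s₁ := upperShadow S (divisiblePart V i)) (s₂ := mulVar i (freePart V i))) (by omega)
    rw [h6]
    exact Finset.subset_union_right
  · right
    refine ⟨h, ?_⟩
    have h6 := Finset.eq_of_subset_of_card_le (mulVar_subset_union hi V)
      (by rw [card_mulVar] at h2 ⊢; omega)
    rw [h6]
    exact Finset.subset_union_left

end UpperShadow

/-! ### The equality case -/

section Equality

variable {σ : Type*} [DecidableEq σ] [Fintype σ]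

lemma mem_finsuppAntidiag_univ {k : ℕ} {v : σ →₀ ℕ} :
    v ∈ Finset.univ.finsuppAntidiag k ↔ v.degree = k := by
  rw [Finset.mem_finsuppAntidiag, Finsupp.degree_eq_sum]
  simp

lemma card_finsuppAntidiag_univ {m : ℕ} (hσ : Fintype.card σ = m + 1) (k : ℕ) :
    ((Finset.univ : Finset σ).finsuppAntidiag k).card = monomialCount m k := by
  rw [Finset.card_finsuppAntidiag_nat_eq_choose, Finset.card_univ, hσ, monomialCount,
    show m + 1 + k - 1 = k + m by omega, Nat.choose_symm_add]

/-- A nonempty set of monomials of degree `d` that is closed under replacing a variable by another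
one contains all monomials of degree `d`. -/
lemma eq_finsuppAntidiag_of_exchange {d : ℕ} {V : Finset (σ →₀ ℕ)} (hne : V.Nonempty)
    (hdeg : ∀ v ∈ V, v.degree = d)
    (hex : ∀ i, upperShadow Finset.univ (divisiblePart V i) ⊆ mulVar i V) :
    V = Finset.univ.finsuppAntidiag d := by
  ext w
  rw [mem_finsuppAntidiag_univ]
  refine ⟨hdeg w, fun hw => ?_⟩
  -- Subtraction is truncated, so this minimises the total excess of v over w; an exchange of an
  -- excessive variable for a deficient one lowers it.
  obtain ⟨v, hv, hmin⟩ := V.exists_min_image (fun v => ∑ j, (v j - w j)) hne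
  have hvw := (hdeg v hv).trans hw.symm
  rw [Finsupp.degree_eq_sum, Finsupp.degree_eq_sum] at hvw
  by_cases hle : ∀ i, v i ≤ w i
  · have : v = w := Finsupp.ext fun i =>
      (Finset.sum_eq_sum_iff_of_le fun i _ => hle i).1 hvw i (Finset.mem_univ i)
    rwa [← this]
  push Not at hle
  obtain ⟨i, hi⟩ := hle
  obtain ⟨j, hj⟩ : ∃ j, v j < w j := by
    by_contra! h
    have := Finset.sum_lt_sum (fun j _ => h j) ⟨i, Finset.mem_univ i, hi⟩
    omega
  obtain ⟨u, hu, huv⟩ := mem_mulVar.1 (hex i (mem_upperShadow.2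
    ⟨j, Finset.mem_univ j, v, mem_divisiblePart.2 ⟨hv, by omega⟩, rfl⟩))
  have hij : i ≠ j := by rintro rfl; omega
  have hval : ∀ k, (if i = k then 1 else 0) + u k = (if j = k then 1 else 0) + v k := fun k => by
    simpa [Finsupp.single_apply] using DFunLike.congr_fun huv k
  refine absurd (hmin u hu) (not_le.2 (Finset.sum_lt_sum (fun k _ => ?_) ⟨i, Finset.mem_univ i, ?_⟩))
  · have := hval k
    split_ifs at this with h1 h2 h2
    · omega
    · omega
    · subst h2; omega
    · omega
  · have := hval i
    rw [if_pos rfl, if_neg hij.symm] at this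
    omega

/-- If equality holds in Macaulay's theorem for `V`, then for some variable `x_i` it holds for the
two parts of `V` as well. -/
lemma exists_variable {m d : ℕ} (hσ : Fintype.card σ = m + 2) {V : Finset (σ →₀ ℕ)}
    (hcard : 1 < V.card) (hdeg : ∀ v ∈ V, v.degree = d)
    (hV : (upperShadow Finset.univ V).card = V.card + growth (m + 1) V.card) :
    ∃ i, mulVar i (freePart V i) ⊆ upperShadow Finset.univ (divisiblePart V i) ∧
      (upperShadow Finset.univ (divisiblePart V i)).card =
        (divisiblePart V i).card + growth (m + 1) (divisiblePart V i).card ∧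
      (upperShadow (Finset.univ.erase i) (freePart V i)).card =
        (freePart V i).card + growth m (freePart V i).card ∧
      growth (m + 1) V.card =
        growth (m + 1) (divisiblePart V i).card + growth m (freePart V i).card := by
  by_contra! hno
  have hex := fun i => (equality_cases (by rw [Finset.card_univ, hσ]) (Finset.mem_univ i)
    hV).resolve_left fun h => hno i h.1 h.2.1 h.2.2.1 h.2.2.2
  have hall := eq_finsuppAntidiag_of_exchange (Finset.card_pos.1 (by omega)) hdeg
    fun i => (hex i).2
  have hV' := card_finsuppAntidiag_univ hσ d
  rw [← hall] at hV'
  cases d with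
  | zero => rw [monomialCount_zero_right] at hV'; omega
  | succ e =>
    obtain ⟨i⟩ : Nonempty σ := Fintype.card_pos_iff.1 (by omega)
    have hdiv : divisiblePart V i = mulVar i (Finset.univ.finsuppAntidiag e) := by
      ext w
      rw [mem_divisiblePart, mem_mulVar, hall, mem_finsuppAntidiag_univ]
      constructor
      · rintro ⟨hw, hwi⟩
        obtain ⟨u, rfl⟩ := exists_add_of_le
          (Finsupp.single_le_iff.2 (Nat.one_le_iff_ne_zero.2 hwi))
        refine ⟨u, mem_finsuppAntidiag_univ.2 ?_, rfl⟩
        rw [map_add, Finsupp.degree_single] at hw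
        omega
      · rintro ⟨u, hu, rfl⟩
        rw [mem_finsuppAntidiag_univ] at hu
        rw [map_add, Finsupp.degree_single]
        exact ⟨by omega, by simp⟩
    -- For V = M^{e+1} the divisible part is x_i M^e, and its size plus growth is exactly |V|,
    -- against the strict inequality.
    have h1 := (hex i).1
    rw [hdiv, card_mulVar, card_finsuppAntidiag_univ hσ, growth_monomialCount,
      ← monomialCount_succ] at h1
    omega

/-- The degree of a coprime set of monomials for which equality holds in Macaulay's theorem is the
smallest possible one. -/
lemma choose_lt_card_of_equality {m d : ℕ} (hσ : Fintype.card σ = m + 2) {V : Finset (σ →₀ ℕ)}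
    (hne : V.Nonempty) (hdeg : ∀ v ∈ V, v.degree = d) (hcop : ∀ i, ∃ v ∈ V, v i = 0)
    (hV : (upperShadow Finset.univ V).card = V.card + growth (m + 1) V.card) :
    (d + m).choose (m + 1) < V.card := by
  induction d generalizing V with
  | zero =>
    rw [Nat.choose_eq_zero_of_lt (by omega)]
    exact Finset.card_pos.2 hne
  | succ d ih =>
    have hcard : 1 < V.card := by
      by_contra! h
      obtain ⟨v, rfl⟩ := Finset.card_eq_one.1 (le_antisymm h (Finset.card_pos.2 hne))
      have hv : v = 0 := Finsupp.ext fun i => by simpa using hcop i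
      have := hdeg v (Finset.mem_singleton_self v)
      simp [hv] at this
    obtain ⟨i, hshift, hdiv, -, hgrowth⟩ := exists_variable hσ hcard hdeg hV
    obtain ⟨v₀, hv₀, hv₀i⟩ := hcop i
    obtain ⟨U, hU⟩ := exists_eq_mulVar (V := divisiblePart V i) (i := i)
      fun v hv => (mem_divisiblePart.1 hv).2
    have hUV : ∀ u ∈ U, Finsupp.single i 1 + u ∈ V := fun u hu => by
      have : Finsupp.single i 1 + u ∈ divisiblePart V i := hU ▸ mem_mulVar.2 ⟨u, hu, rfl⟩
      exact (mem_divisiblePart.1 this).1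
    have hfree : ∀ v ∈ freePart V i, ∃ u ∈ U, u ≤ v := fun v hv => by
      obtain ⟨j, -, w, hw, hvw⟩ := mem_upperShadow.1 (hshift (mem_mulVar.2 ⟨v, hv, rfl⟩))
      rw [hU] at hw
      obtain ⟨u, hu, rfl⟩ := mem_mulVar.1 hw
      rw [add_left_comm, add_right_inj] at hvw
      exact ⟨u, hu, hvw ▸ le_add_self⟩
    have hfree_pos : 1 ≤ (freePart V i).card :=
      Finset.card_pos.2 ⟨v₀, mem_freePart.2 ⟨hv₀, hv₀i⟩⟩
    have hUcard : (divisiblePart V i).card = U.card := by rw [hU, card_mulVar]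
    obtain ⟨u₀, hu₀, -⟩ := hfree v₀ (mem_freePart.2 ⟨hv₀, hv₀i⟩)
    -- U is coprime because every element of V, free or not, is a multiple of some element of U.
    have hlt := ih (V := U) ⟨u₀, hu₀⟩
      (fun u hu => by
        have := hdeg _ (hUV u hu)
        rw [map_add, Finsupp.degree_single] at this
        omega)
      (fun j => by
        by_contra! h
        obtain ⟨v, hv, hvj⟩ := hcop j
        by_cases hvi : v i = 0
        · obtain ⟨u, hu, huv⟩ := hfree v (mem_freePart.2 ⟨hv, hvi⟩)
          have := huv j
          have := h u hu
          omega
        · have hv' : v ∈ divisiblePart V i := mem_divisiblePart.2 ⟨hv, hvi⟩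
          rw [hU] at hv'
          obtain ⟨u, hu, rfl⟩ := mem_mulVar.1 hv'
          have := h u hu
          rw [Finsupp.add_apply] at hvj
          omega)
      (by rw [hU, upperShadow_mulVar, card_mulVar, card_mulVar] at hdiv; exact hdiv)
    rw [← hUcard] at hlt
    have := card_divisiblePart_add_card_freePart V i
    rw [← this] at hgrowth ⊢
    have := monomialCount_lt_add_of_growth_eq hfree_pos hlt hgrowth
    rwa [monomialCount, show d + (m + 1) = d + 1 + m by ring] at this

end Equality

/-! ### Gotzmann sets, gcds and dropping a variable -/

section Translation

variable {σ : Type*}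

lemma exists_eq_single_of_degree_eq_one {u : σ →₀ ℕ} (hu : u.degree = 1) :
    ∃ j, u = Finsupp.single j 1 := by
  obtain ⟨j, hj⟩ : ∃ j, u j ≠ 0 := by
    by_contra! h
    obtain rfl : u = 0 := Finsupp.ext h
    simp at hu
  obtain ⟨r, rfl⟩ := exists_add_of_le (Finsupp.single_le_iff.2 (Nat.one_le_iff_ne_zero.2 hj))
  rw [map_add, Finsupp.degree_single, Nat.add_eq_left, Finsupp.degree_eq_zero_iff] at hu
  exact ⟨j, by rw [hu, add_zero]⟩

lemma isGotzmannSet_iff [DecidableEq σ] [Fintype σ] (K : Type*) [Field K] (d : ℕ)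
    (V : Finset (σ →₀ ℕ)) :
    IsGotzmannSet K d V ↔ (∀ v ∈ V, v.degree = d) ∧
      (upperShadow Finset.univ V).card = V.card + growth (Fintype.card σ - 1) V.card := by
  refine and_congr_right fun hdeg => ?_
  rw [hilbertFunction_monomialIdeal K V V d, upperPower_eq,
    hilbertFunction_monomialIdeal K V (upperShadow Finset.univ V) (d + 1)]
  · intro w
    rw [mem_upperShadow]
    constructor
    · rintro ⟨j, -, v, hv, rfl⟩
      refine ⟨?_, v, hv, le_add_self⟩
      rw [map_add, Finsupp.degree_single, hdeg v hv, add_comm]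
    · rintro ⟨hw, v, hv, hvw⟩
      obtain ⟨u, rfl⟩ := exists_add_of_le hvw
      rw [map_add, hdeg v hv, Nat.add_left_cancel_iff] at hw
      obtain ⟨j, rfl⟩ := exists_eq_single_of_degree_eq_one hw
      exact ⟨j, Finset.mem_univ j, v, hv, add_comm _ _⟩
  · intro w
    constructor
    · exact fun hw => ⟨hdeg w hw, w, hw, le_rfl⟩
    · rintro ⟨hw, v, hv, hvw⟩
      obtain ⟨u, rfl⟩ := exists_add_of_le hvw
      rw [map_add, hdeg v hv, Nat.add_eq_left, Finsupp.degree_eq_zero_iff] at hw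
      rwa [hw, add_zero]

lemma exists_apply_eq_zero {V : Finset (σ →₀ ℕ)} (hne : V.Nonempty) (hgcd : monomialGcd V = 0)
    (i : σ) : ∃ v ∈ V, v i = 0 := by
  by_contra! h
  have hle : Finsupp.single i 1 ≤ monomialGcd V := by
    rw [monomialGcd, dif_pos hne]
    exact Finset.le_inf' _ _ fun v hv => Finsupp.single_le_iff.2 (Nat.one_le_iff_ne_zero.2 (h v hv))
  rw [hgcd, Finsupp.single_le_iff] at hle
  simp at hle

lemma V0_eq {V : Finset (σ →₀ ℕ)} (hcard : 1 < V.card) (hgcd : monomialGcd V = 0) (i : σ) :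
    V0 V i = divisiblePart V i := by
  classical
  ext v
  rw [V0, if_pos hcard, Finset.mem_filter, mem_divisiblePart, hgcd, add_zero,
    Finsupp.single_le_iff, Nat.one_le_iff_ne_zero]

lemma Vd_eq {V : Finset (σ →₀ ℕ)} (hcard : 1 < V.card) (hgcd : monomialGcd V = 0) (i : σ) :
    Vd V i = freePart V i := by
  classical
  ext v
  rw [Vd, Finset.mem_sdiff, V0_eq hcard hgcd, mem_divisiblePart, mem_freePart]
  tauto

lemma shiftCondition_of_subset [DecidableEq σ] {S : Finset σ} {V : Finset (σ →₀ ℕ)}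
    (hcard : 1 < V.card) (hgcd : monomialGcd V = 0) {i : σ}
    (h : mulVar i (freePart V i) ⊆ upperShadow S (divisiblePart V i)) : ShiftCondition V i := by
  intro v hv
  rw [Vd_eq hcard hgcd] at hv
  obtain ⟨j, -, w, hw, hvw⟩ := mem_upperShadow.1 (h (mem_mulVar.2 ⟨v, hv, rfl⟩))
  refine ⟨j, ?_, w, by rwa [V0_eq hcard hgcd], hvw.symm⟩
  rintro rfl
  rw [add_right_inj] at hvw
  exact (mem_divisiblePart.1 hw).2 (hvw ▸ (mem_freePart.1 hv).2)

lemma V0_nonempty_of_shiftCondition {V : Finset (σ →₀ ℕ)} (hne : V.Nonempty) {i : σ}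
    (h : ShiftCondition V i) : (V0 V i).Nonempty := by
  classical
  by_contra h0
  rw [Finset.not_nonempty_iff_eq_empty] at h0
  obtain ⟨v, hv⟩ := hne
  obtain ⟨-, -, w, hw, -⟩ := h v (by rw [Vd, h0, Finset.sdiff_empty]; exact hv)
  simp [h0] at hw

/-- The gcd of V_{0,i} divided by x_i divides all of V: for v outside V_{0,i}, the gcd divides some
w with x_i v = x_j w. As gcd(V) = 1, the quotient is 1. -/
lemma monomialGcd_V0_of_shiftCondition {V : Finset (σ →₀ ℕ)} (hcard : 1 < V.card)
    (hgcd : monomialGcd V = 0) {i : σ} (h : ShiftCondition V i) :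
    monomialGcd (V0 V i) = Finsupp.single i 1 := by
  classical
  have hne : V.Nonempty := Finset.card_pos.1 (by omega)
  have hne0 := V0_nonempty_of_shiftCondition hne h
  have hle : ∀ w ∈ V0 V i, monomialGcd (V0 V i) ≤ w := fun w hw => by
    rw [monomialGcd, dif_pos hne0]
    exact Finset.inf'_le id hw
  refine le_antisymm ?_ ?_
  · rw [← add_zero (Finsupp.single i 1), ← tsub_le_iff_left, ← hgcd, monomialGcd, monomialGcd,
      dif_pos hne, ← monomialGcd.eq_def]
    refine Finset.le_inf' _ _ fun v hv => ?_
    by_cases hv0 : v ∈ V0 V i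
    · exact tsub_le_self.trans (hle v hv0)
    · obtain ⟨j, -, w, hw, hvw⟩ := h v (Finset.mem_sdiff.2 ⟨hv, hv0⟩)
      rw [id, tsub_le_iff_left, hvw]
      exact (hle w hw).trans le_add_self
  · rw [monomialGcd, dif_pos hne0]
    refine Finset.le_inf' _ _ fun v hv => ?_
    rw [V0_eq hcard hgcd, mem_divisiblePart] at hv
    exact Finsupp.single_le_iff.2 (Nat.one_le_iff_ne_zero.2 hv.2)

section DropVar

variable {i : σ} {W : Finset (σ →₀ ℕ)}

lemma injOn_subtypeDomain_ne (hW : ∀ w ∈ W, w i = 0) :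
    Set.InjOn (Finsupp.subtypeDomain (M := ℕ) fun j => j ≠ i) W := by
  intro v hv w hw hvw
  ext j
  by_cases hj : j = i
  · rw [hj, hW v hv, hW w hw]
  · exact DFunLike.congr_fun hvw ⟨j, hj⟩

lemma card_dropVar (hW : ∀ w ∈ W, w i = 0) : (dropVar W i).card = W.card := by
  classical
  exact Finset.card_image_of_injOn (injOn_subtypeDomain_ne hW)

lemma mem_dropVar {u : {j : σ // j ≠ i} →₀ ℕ} :
    u ∈ dropVar W i ↔ ∃ w ∈ W, Finsupp.subtypeDomain (fun j => j ≠ i) w = u := by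
  classical
  exact Finset.mem_image

variable [DecidableEq σ]

lemma subtypeDomain_single_ne (j : {j : σ // j ≠ i}) :
    Finsupp.subtypeDomain (fun j => j ≠ i) (Finsupp.single (j : σ) 1) = Finsupp.single j 1 := by
  ext k
  simp [Finsupp.single_apply, Subtype.ext_iff]

variable [Fintype σ]

lemma degree_subtypeDomain_ne {w : σ →₀ ℕ} (hw : w i = 0) :
    (Finsupp.subtypeDomain (fun j => j ≠ i) w).degree = w.degree := by
  rw [Finsupp.degree_eq_sum, Finsupp.degree_eq_sum, Fintype.sum_eq_add_sum_subtype_ne _ i, hw,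
    zero_add]
  rfl

lemma upperShadow_dropVar :
    upperShadow Finset.univ (dropVar W i) = dropVar (upperShadow (Finset.univ.erase i) W) i := by
  ext u
  simp only [mem_upperShadow, mem_dropVar]
  constructor
  · rintro ⟨j, -, _, ⟨w, hw, rfl⟩, rfl⟩
    refine ⟨_, ⟨j, Finset.mem_erase.2 ⟨j.2, Finset.mem_univ _⟩, w, hw, rfl⟩, ?_⟩
    rw [Finsupp.subtypeDomain_add, subtypeDomain_single_ne]
  · rintro ⟨_, ⟨j, hj, w, hw, rfl⟩, rfl⟩
    refine ⟨⟨j, Finset.ne_of_mem_erase hj⟩, Finset.mem_univ _, _, ⟨w, hw, rfl⟩, ?_⟩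
    rw [Finsupp.subtypeDomain_add, ← subtypeDomain_single_ne]

lemma isGotzmannSet_dropVar (K : Type*) [Field K] {m d : ℕ} (hσ : Fintype.card σ = m + 2)
    (hW : ∀ w ∈ W, w i = 0) (hdeg : ∀ w ∈ W, w.degree = d)
    (h : (upperShadow (Finset.univ.erase i) W).card = W.card + growth m W.card) :
    IsGotzmannSet K d (dropVar W i) := by
  rw [isGotzmannSet_iff, upperShadow_dropVar, card_dropVar hW, card_dropVar, h]
  · refine ⟨fun u hu => ?_, ?_⟩
    · obtain ⟨w, hw, rfl⟩ := mem_dropVar.1 hu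
      rw [degree_subtypeDomain_ne (hW w hw), hdeg w hw]
    · have : Fintype.card {j : σ // j ≠ i} - 1 = m := by
        rw [Fintype.card_subtype_compl, Fintype.card_subtype_eq, hσ]
        rfl
      rw [this]
  · intro v hv
    obtain ⟨j, hj, w, hw, rfl⟩ := mem_upperShadow.1 hv
    simp [hW w hw, Finset.ne_of_mem_erase hj]

end DropVar

end Translation

/-! ### Degree from size, and the theorem -/

lemma binom_natCast (a k : ℕ) : binom a k = a.choose k := by
  simp [binom]

/-- The degree of a coprime Gotzmann set is determined by its size. -/
theorem degree_eq_of_isGotzmannSet {K : Type*} [Field K] {n : ℕ} (hn : 1 ≤ n) {d : ℕ} {α : ℤ}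
    {V : Finset (Fin n →₀ ℕ)} (hV : IsGotzmannSet K d V) (hgcd : monomialGcd V = 0)
    (hlower : binom (α + n - 1) (n - 1) < V.card) (hupper : V.card ≤ binom (α + n) (n - 1)) :
    (d : ℤ) = α + 1 := by
  obtain ⟨m, rfl⟩ : ∃ m, n = m + 1 := ⟨n - 1, by omega⟩
  have hne : V.Nonempty := Finset.card_pos.1 (by omega)
  have hcop := exists_apply_eq_zero hne hgcd
  rw [isGotzmannSet_iff, Fintype.card_fin] at hV
  obtain ⟨hdeg, hV⟩ := hV
  simp only [Nat.add_sub_cancel] at *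
  obtain ⟨e, rfl⟩ : ∃ e : ℕ, α = e - 1 := by
    have h0 : 0 < binom (α + (m + 1 : ℕ)) m := by omega
    rw [binom] at h0
    split_ifs at h0 with h
    · have := Nat.choose_ne_zero_iff.1 h0.ne'
      exact ⟨(α + 1).toNat, by omega⟩
    · omega
  rw [show (e : ℤ) - 1 + (m + 1 : ℕ) = (e + m : ℕ) by push_cast; ring, binom_natCast] at hupper
  rcases m with _ | m
  · have hd : d = 0 := by
      obtain ⟨v, hv, hv0⟩ := hcop 0
      rw [← hdeg v hv, Finsupp.degree_eq_sum]
      simpa using hv0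
    -- In one variable α = -1 is forced: the lower binomial vanishes only for a negative top, while
    -- for α ≥ 0 both bounds equal 1.
    rcases e with _ | e
    · simp [hd]
    · rw [show ((e + 1 : ℕ) : ℤ) - 1 + (0 + 1 : ℕ) - 1 = (e : ℕ) by push_cast; ring,
        binom_natCast, Nat.choose_zero_right] at hlower
      rw [Nat.choose_zero_right] at hupper
      omega
  · rw [show (e : ℤ) - 1 + (m + 1 + 1 : ℕ) - 1 = (e + m : ℕ) by push_cast; ring,
      binom_natCast] at hlower
    have h1 := choose_lt_card_of_equality (Fintype.card_fin _) hne hdeg hcop hV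
    have h2 : V.card ≤ (d + (m + 1)).choose (m + 1) := by
      rw [← monomialCount, ← card_finsuppAntidiag_univ (Fintype.card_fin (m + 1 + 1))]
      exact Finset.card_le_card fun v hv => mem_finsuppAntidiag_univ.2 (hdeg v hv)
    have h3 : d = e := by
      rcases lt_trichotomy d e with h | h | h
      · have := Nat.choose_le_choose (m + 1) (show d + (m + 1) ≤ e + m by omega)
        omega
      · exact h
      · have := Nat.choose_le_choose (m + 1) (show e + (m + 1) ≤ d + m by omega)
        omega
    omega

end GotzmannMonomial

theorem mainTheorem3 (K : Type*) [Field K] (n : ℕ) (hn : 1 ≤ n) (d : ℕ) (α : ℤ)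
    (V : Finset (Fin n →₀ ℕ))
    (hV : GotzmannMonomial.IsGotzmannSet K d V)
    (hgcd : GotzmannMonomial.monomialGcd V = 0)
    (hlower : GotzmannMonomial.binom (α + n - 1) (n - 1) < V.card)
    (hupper : V.card ≤ GotzmannMonomial.binom (α + n) (n - 1)) :
    (d : ℤ) = α + 1 ∧
    (1 < V.card →
      (∀ i : Fin n, GotzmannMonomial.ShiftCondition V i →
        (GotzmannMonomial.V0 V i).Nonempty ∧
          GotzmannMonomial.monomialGcd (GotzmannMonomial.V0 V i) = Finsupp.single i 1) ∧
      ∃ i : Fin n, GotzmannMonomial.ShiftCondition V i ∧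
        GotzmannMonomial.IsGotzmannSet K d (GotzmannMonomial.V0 V i) ∧
        GotzmannMonomial.IsGotzmannSet K d
          (GotzmannMonomial.dropVar (GotzmannMonomial.Vd V i) i)) ∧
    (∀ (d' : ℕ) (V' : Finset (Fin n →₀ ℕ)), GotzmannMonomial.IsGotzmannSet K d' V' →
      GotzmannMonomial.monomialGcd V' = 0 → V'.card = V.card → d' = d) ∧
    (V.card = GotzmannMonomial.binom (α + n) (n - 1) →
      (V : Set (Fin n →₀ ℕ)) = {v | (v.degree : ℤ) = α + 1}) := by
  refine ⟨GotzmannMonomial.degree_eq_of_isGotzmannSet hn hV hgcd hlower hupper, fun hcard =>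
    ⟨fun i hi => ⟨GotzmannMonomial.V0_nonempty_of_shiftCondition
      (Finset.card_pos.1 (by omega)) hi,
      GotzmannMonomial.monomialGcd_V0_of_shiftCondition hcard hgcd hi⟩, ?_⟩,
    fun d' V' hV' hgcd' hcard' => ?_, fun hcard => ?_⟩
  · have hV₁ := hV
    rw [GotzmannMonomial.isGotzmannSet_iff, Fintype.card_fin] at hV₁
    obtain ⟨hdeg, hV₁⟩ := hV₁
    obtain ⟨m, rfl⟩ : ∃ m, n = m + 2 := by
      refine ⟨n - 2, ?_⟩
      by_contra hn2
      obtain rfl : n = 1 := by omega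
      refine absurd (Finset.card_le_one.2 fun v hv w hw => ?_) (not_le.2 hcard)
      have h := (hdeg v hv).trans (hdeg w hw).symm
      rw [Finsupp.degree_eq_sum, Finsupp.degree_eq_sum] at h
      refine Finsupp.ext fun i => ?_
      rw [Subsingleton.elim i 0]
      simpa using h
    obtain ⟨i, hshift, hdiv, hfree, -⟩ :=
      GotzmannMonomial.exists_variable (Fintype.card_fin _) hcard hdeg hV₁
    refine ⟨i, GotzmannMonomial.shiftCondition_of_subset hcard hgcd hshift, ?_, ?_⟩
    · rw [GotzmannMonomial.V0_eq hcard hgcd, GotzmannMonomial.isGotzmannSet_iff, Fintype.card_fin]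
      exact ⟨fun v hv => hdeg v (GotzmannMonomial.mem_divisiblePart.1 hv).1, hdiv⟩
    · rw [GotzmannMonomial.Vd_eq hcard hgcd]
      exact GotzmannMonomial.isGotzmannSet_dropVar K (Fintype.card_fin _)
        (fun w hw => (GotzmannMonomial.mem_freePart.1 hw).2)
        (fun w hw => hdeg w (GotzmannMonomial.mem_freePart.1 hw).1) hfree
  · have h := GotzmannMonomial.degree_eq_of_isGotzmannSet hn hV hgcd hlower hupper
    rw [← hcard'] at hlower hupper
    have h' := GotzmannMonomial.degree_eq_of_isGotzmannSet hn hV' hgcd' hlower hupper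
    omega
  · have h := GotzmannMonomial.degree_eq_of_isGotzmannSet hn hV hgcd hlower hupper
    have hsub : V ⊆ Finset.univ.finsuppAntidiag d := fun v hv =>
      GotzmannMonomial.mem_finsuppAntidiag_univ.2 (hV.1 v hv)
    have heq := Finset.eq_of_subset_of_card_le hsub (by
      rw [GotzmannMonomial.card_finsuppAntidiag_univ (m := n - 1)
        (by rw [Fintype.card_fin]; omega), hcard,
        show α + n = (d + (n - 1) : ℕ) by omega, GotzmannMonomial.binom_natCast,
        GotzmannMonomial.monomialCount])
    ext v
    rw [heq, Finset.mem_coe, GotzmannMonomial.mem_finsuppAntidiag_univ, Set.mem_ofPred_eq, ← h,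
      Nat.cast_inj]
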